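/- **Conventions.** An $[[n,k]]$ stabilizer code $\mathcal{Q}$ is given by an abelian group $\mathcal{S}$ of $n$-qubit Pauli operators with $n-k$ independent generators and $-I\notin\mathcal{S}$; its code space is the joint $+1$ eigenspace of $\mathcal{S}$. It is a *self-dual CSS code* if, for some matrix $A\in\mathbb{Z}_2^{r\times n}$ with $2r=n-k$, $\mathcal{S}$ is generated by the $X$-type and the $Z$-type Pauli operators given by the rows of $A$. A *symplectic basis* of $\mathcal{Q}$ consists of Hermitian Pauli operators $\bar X_j,\bar Z_j$ ($1\le j\le k$) commuting with $\mathcal{S}$ such that $\bar X_j,\bar Z_j$ anticommute, all other pairs of these operators commute, and these operators together with $\mathcal{S}$ and $iI$ generate the centralizer of $\mathcal{S}$ in the Pauli group. It defines the $k$ logical qubits of $\mathcal{Q}$: a gate on the logical qubits acts on the code space by substituting $\bar X_j,\bar Z_j$ for $X_j,Z_j$; the logical gates obtained in this way from $H_j$, $S_j$ are denoted $\bar H_j$, $\bar S_j$. Equality of gates means equality on the code space up to a global phase. A symplectic basis is *compatible* if $\bigotimes_{j=1}^k\bar H_j=\bigotimes_{i=1}^n H_i$ and for every $a\in\{\pm1\}^k$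 there is $b\in\{\pm1\}^n$ with $\bigotimes_{j=1}^k\bar S_j^{a_j}=\bigotimes_{i=1}^n S_i^{b_i}$, where $H$ is the Hadamard gate and $S=\mathrm{diag}(1,i)$. Given $[[n_l,k_l]]$ stabilizer codes $\mathcal{Q}_l$ with symplectic bases ($1\le l\le L$), the *concatenated code* $\mathcal{Q}_L\circ\cdots\circ\mathcal{Q}_1$ has physical qubits (level $0$) labelled by $[n_1]\times\cdots\times[n_L]$ and logical qubits at level $l$ labelled by $[k_1]\times\cdots\times[k_l]\times[n_{l+1}]\times\cdots\times[n_L]$; there are $N^{(l)}=\prod_{i\le l}k_i\prod_{i>l}n_i$ of them, and $N=N^{(0)}$, $K=N^{(L)}$. For all $(j_1,\dots,j_{l-1},i_{l+1},\dots,i_L)$, the code $\mathcal{Q}_l$ encodes the $k_l$ logical qubits $(j_1,\dots,j_{l-1},\cdot,i_{l+1},\dots,i_L)$ at level $l$ into the $n_l$ logical qubits $(j_1,\dots,j_{l-1},\cdot,i_{l+1},\dots,i_L)$ at level $l-1$. $G^{(l)}_q$ denotes the single-qubit gate $G$ on the logical qubit $q$ at level $l$. A gate is *transversal at level $m$* if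 it equals $\bigotimes_{q=1}^{N^{(m)}}G^{(m)}_q$ for some single-qubit (unitary) gates $G_q$ acting on the logical qubits at level $m$. **Corollary.** Let $\mathcal{Q}_1,\dots,\mathcal{Q}_L$ be self-dual CSS codes with $k_l\ge1$, the logical Pauli operators of each being defined by a compatible symplectic basis, and consider the concatenated code $\mathcal{Q}_L\circ\cdots\circ\mathcal{Q}_1$. Then: 1. $\bigotimes_{j=1}^{K}H^{(L)}_j$ is transversal at levels $0,\dots,L$ and equals $\bigotimes_{i=1}^{N}H^{(0)}_i$. 2. For every $a\in\{\pm1\}^K$, $\bigotimes_{j=1}^{K}\bigl(S^{(L)}_j\bigr)^{a_j}$ is transversal at levels $0,\dots,L$ and equals $\bigotimes_{i=1}^{N}\bigl(S^{(0)}_i\bigr)^{b_i}$ for some $b\in\{\pm1\}^N$. -/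

import Mathlib

open scoped Matrix

noncomputable section

namespace QCode

/-! ### Qubits, gates, Pauli operators -/

/-- States (not necessarily normalized) of qubits labelled by `ι`, in the computational basis. -/
abbrev State (ι : Type) : Type := (ι → Fin 2) → ℂ

/-- Linear operators on the state space of qubits labelled by `ι`. -/
abbrev Op (ι : Type) : Type := Matrix (ι → Fin 2) (ι → Fin 2) ℂ

/-- The tensor product `⨂ i, G i` of single-qubit operators. -/
def tensor {ι : Type} [Fintype ι] (G : ι → Matrix (Fin 2) (Fin 2) ℂ) : Op ι :=
  Matrix.of fun x y => ∏ i, G i (x i) (y i)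

def pauliX : Matrix (Fin 2) (Fin 2) ℂ := !![0, 1; 1, 0]

def pauliZ : Matrix (Fin 2) (Fin 2) ℂ := !![1, 0; 0, -1]

/-- The Hadamard gate `H`. -/
def hadamard : Matrix (Fin 2) (Fin 2) ℂ := ((Real.sqrt 2 : ℝ) : ℂ)⁻¹ • !![1, 1; 1, -1]

/-- The phase gate `S`. -/
def phase : Matrix (Fin 2) (Fin 2) ℂ := !![1, 0; 0, Complex.I]

/-- The `X`-type Pauli operator with binary vector `u`. -/
def xOp {ι : Type} [Fintype ι] (u : ι → ZMod 2) : Op ι :=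
  tensor fun i => if u i = 1 then pauliX else 1

/-- The `Z`-type Pauli operator with binary vector `u`. -/
def zOp {ι : Type} [Fintype ι] (u : ι → ZMod 2) : Op ι :=
  tensor fun i => if u i = 1 then pauliZ else 1

/-- Membership in the Pauli group (phases `±1, ±i`). -/
def IsPauli {ι : Type} [Fintype ι] [DecidableEq ι] (P : Op ι) : Prop :=
  ∃ (t : ℕ) (u v : ι → ZMod 2), P = Complex.I ^ t • (xOp u * zOp v)

/-- `U` and `V` agree, up to a global phase, on the subspace `W`. -/
def EqOn {ι : Type} [Fintype ι] [DecidableEq ι] (W : Submodule ℂ (State ι)) (U V : Op ι) : Prop :=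
  ∃ c : ℂ, ‖c‖ = 1 ∧ ∀ ψ ∈ W, U *ᵥ ψ = c • (V *ᵥ ψ)

/-- The simultaneous `+1` eigenspace of a set of operators. -/
def fixedSpace {ι : Type} [Fintype ι] [DecidableEq ι] (T : Set (Op ι)) : Submodule ℂ (State ι) where
  carrier := {ψ | ∀ g ∈ T, g *ᵥ ψ = ψ}
  add_mem' := by
    intro a b ha hb g hg
    rw [Matrix.mulVec_add, ha g hg, hb g hg]
  zero_mem' := by
    intro g _
    exact Matrix.mulVec_zero g
  smul_mem' := by
    intro c a ha g hg
    rw [Matrix.mulVec_smul, ha g hg]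

/-! ### Stabilizer codes and symplectic bases -/

/-- A stabilizer code encoding `k` logical qubits into `n` physical qubits, given by its stabilizer
group: an abelian group of Pauli operators without `-1`, with `n - k` independent generators. -/
structure StabilizerCode (n k : ℕ) where
  stab : Subgroup (Matrix.unitaryGroup (Fin n → Fin 2) ℂ)
  isPauli : ∀ g ∈ stab, IsPauli (g : Op (Fin n))
  comm : ∀ g ∈ stab, ∀ h ∈ stab, g * h = h * g
  neg_one_notMem : ∀ g ∈ stab, (g : Op (Fin n)) ≠ -1
  le : k ≤ n
  card : Nat.card stab = 2 ^ (n - k)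

/-- The set of stabilizers, as operators. -/
def StabilizerCode.ops {n k : ℕ} (Q : StabilizerCode n k) : Set (Op (Fin n)) :=
  {g | ∃ s ∈ Q.stab, (s : Op (Fin n)) = g}

def StabilizerCode.codeSpace {n k : ℕ} (Q : StabilizerCode n k) : Submodule ℂ (State (Fin n)) :=
  fixedSpace Q.ops

/-- The code is a CSS code whose two check matrices coincide (`H_x = H_z`, with `r = (n - k) / 2`
rows). -/
def StabilizerCode.IsSelfDualCSS {n k : ℕ} (Q : StabilizerCode n k) : Prop :=
  ∃ r : ℕ, n = k + 2 * r ∧ ∃ A : Matrix (Fin r) (Fin n) (ZMod 2),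
    Q.stab = Subgroup.closure
      {g : Matrix.unitaryGroup (Fin n → Fin 2) ℂ | ∃ i, (g : Op (Fin n)) = xOp (A i) ∨
        (g : Op (Fin n)) = zOp (A i)}

/-- A symplectic basis: `k` hyperbolic pairs of Hermitian Pauli operators `(X j, Z j)` in the
centralizer of the stabilizer group which, together with the stabilizers and `i`, generate the
centralizer (in the Pauli group). These are the logical Pauli operators. -/
structure SymplecticBasis {n k : ℕ} (Q : StabilizerCode n k) where
  X : Fin k → Matrix.unitaryGroup (Fin n → Fin 2) ℂ
  Z : Fin k → Matrix.unitaryGroup (Fin n → Fin 2) ℂ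
  isPauli_X : ∀ j, IsPauli (X j : Op (Fin n))
  isPauli_Z : ∀ j, IsPauli (Z j : Op (Fin n))
  X_sq : ∀ j, X j * X j = 1
  Z_sq : ∀ j, Z j * Z j = 1
  X_stab : ∀ j, ∀ g ∈ Q.stab, X j * g = g * X j
  Z_stab : ∀ j, ∀ g ∈ Q.stab, Z j * g = g * Z j
  anticomm : ∀ j,
    (X j : Op (Fin n)) * (Z j : Op (Fin n)) = -((Z j : Op (Fin n)) * (X j : Op (Fin n)))
  X_Z : ∀ j j', j ≠ j' → X j * Z j' = Z j' * X j
  X_X : ∀ j j', X j * X j' = X j' * X j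
  Z_Z : ∀ j j', Z j * Z j' = Z j' * Z j
  generate : ∀ P : Matrix.unitaryGroup (Fin n → Fin 2) ℂ, IsPauli (P : Op (Fin n)) →
    (∀ g ∈ Q.stab, P * g = g * P) →
    P ∈ Subgroup.closure ((Q.stab : Set (Matrix.unitaryGroup (Fin n → Fin 2) ℂ)) ∪
      Set.range X ∪ Set.range Z ∪ {g | (g : Op (Fin n)) = Complex.I • (1 : Op (Fin n))})

namespace SymplecticBasis

variable {n k : ℕ} {Q : StabilizerCode n k}

/-- The logical operator `∏ j, X_j ^ (x j)`. -/
def xPow (B : SymplecticBasis Q) (x : Fin k → Fin 2) : Op (Fin n) :=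
  (List.ofFn fun j => (B.X j : Op (Fin n)) ^ (x j : ℕ)).prod

/-- The projector `∏ j, (1 + Z_j) / 2` on the common `+1` eigenspace of the logical `Z` operators;
on the code space it is the projector on the logical state `|0…0⟩`. -/
def zeroProj (B : SymplecticBasis Q) : Op (Fin n) :=
  (List.ofFn fun j => (2 : ℂ)⁻¹ • (1 + (B.Z j : Op (Fin n)))).prod

/-- The logical gate `U` on the `k` logical qubits, as an operator on the physical qubits. The
logical basis states are `|x⟩ = (∏ j, X_j ^ (x j)) |0…0⟩`, and on the code space this operator is
`∑ x y, U x y |x⟩⟨y|`. The formula is the substitution of the logical Pauli operators `X j`, `Z j`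
for the Pauli operators on qubit `j` in `U`. -/
def logical (B : SymplecticBasis Q) (U : Op (Fin k)) : Op (Fin n) :=
  ∑ x, ∑ y, U x y • (B.xPow x * B.zeroProj * (B.xPow y)ᴴ)

/-- The symplectic basis is compatible with multilevel transversal Clifford operations. -/
structure IsCompatible (B : SymplecticBasis Q) : Prop where
  hadamard : EqOn Q.codeSpace
    (B.logical (tensor fun _ => QCode.hadamard)) (tensor fun _ => QCode.hadamard)
  phase : ∀ a : Fin k → ℤˣ, ∃ b : Fin n → ℤˣ, EqOn Q.codeSpace
    (B.logical (tensor fun j => QCode.phase ^ ((a j : ℤˣ) : ℤ)))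
    (tensor fun i => QCode.phase ^ ((b i : ℤˣ) : ℤ))

end SymplecticBasis

/-- A stabilizer code together with the symplectic basis that defines its logical qubits. -/
structure BasedCode where
  n : ℕ
  k : ℕ
  code : StabilizerCode n k
  basis : SymplecticBasis code

/-! ### Tensor powers of operator maps -/

/-- For a linear map `Φ` of operators, the map `⨂ r, Φ`, applied to the block of qubits `(·, r)`
for each `r`. -/
def onCols {A B R : Type} [Fintype A] [DecidableEq A] [Fintype R] [DecidableEq R]
    (Φ : Op A → Op B) (U : Op (A × R)) : Op (B × R) :=
  Matrix.of fun x y => ∑ a, ∑ b, U a b *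
    ∏ r, Φ (Matrix.single (fun i => a (i, r)) (fun i => b (i, r)) 1)
      (fun i => x (i, r)) (fun i => y (i, r))

/-- For a linear map `Φ` of operators, the map `⨂ r, Φ`, applied to the block of qubits `(r, ·)`
for each `r`. -/
def onRows {A B R : Type} [Fintype A] [DecidableEq A] [Fintype R] [DecidableEq R]
    (Φ : Op A → Op B) (U : Op (R × A)) : Op (R × B) :=
  Matrix.of fun x y => ∑ a, ∑ b, U a b *
    ∏ r, Φ (Matrix.single (fun i => a (r, i)) (fun i => b (r, i)) 1)
      (fun i => x (r, i)) (fun i => y (r, i))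

/-- The operator `g` on the block of qubits `(·, r)`, the identity on all other qubits. -/
def atCol {A R : Type} [Fintype A] [Fintype R] [DecidableEq R] (r : R) (g : Op A) : Op (A × R) :=
  Matrix.of fun x y =>
    if ∀ i r', r' ≠ r → x (i, r') = y (i, r') then g (fun i => x (i, r)) (fun i => y (i, r)) else 0

/-- The operator `g` on the block of qubits `(r, ·)`, the identity on all other qubits. -/
def atRow {A R : Type} [Fintype A] [Fintype R] [DecidableEq R] (r : R) (g : Op A) : Op (R × A) :=
  Matrix.of fun x y =>
    if ∀ i r', r' ≠ r → x (r', i) = y (r', i) then g (fun i => x (r, i)) (fun i => y (r, i)) else 0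

/-! ### Concatenated codes

The innermost code `Q_1` is `C 0`, the outermost code `Q_L` is `C (L - 1)`. -/

/-- Labels of the logical qubits at level `l`:
`[k_1] × ⋯ × [k_l] × [n_{l+1}] × ⋯ × [n_L]` (with a one-point factor at the end). -/
def Qubit : {L : ℕ} → (Fin L → BasedCode) → ℕ → Type
  | 0, _, _ => Unit
  | _ + 1, C, 0 => Fin (C 0).n × Qubit (fun i => C i.succ) 0
  | _ + 1, C, l + 1 => Fin (C 0).k × Qubit (fun i => C i.succ) l

instance Qubit.instFintype : {L : ℕ} → (C : Fin L → BasedCode) → (l : ℕ) → Fintype (Qubit C l)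
  | 0, _, _ => inferInstanceAs (Fintype Unit)
  | _ + 1, C, 0 =>
    letI := Qubit.instFintype (fun i => C i.succ) 0
    inferInstanceAs (Fintype (Fin (C 0).n × Qubit (fun i => C i.succ) 0))
  | _ + 1, C, l + 1 =>
    letI := Qubit.instFintype (fun i => C i.succ) l
    inferInstanceAs (Fintype (Fin (C 0).k × Qubit (fun i => C i.succ) l))

instance Qubit.instDecidableEq :
    {L : ℕ} → (C : Fin L → BasedCode) → (l : ℕ) → DecidableEq (Qubit C l)
  | 0, _, _ => inferInstanceAs (DecidableEq Unit)
  | _ + 1, C, 0 =>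
    letI := Qubit.instDecidableEq (fun i => C i.succ) 0
    inferInstanceAs (DecidableEq (Fin (C 0).n × Qubit (fun i => C i.succ) 0))
  | _ + 1, C, l + 1 =>
    letI := Qubit.instDecidableEq (fun i => C i.succ) l
    inferInstanceAs (DecidableEq (Fin (C 0).k × Qubit (fun i => C i.succ) l))

/-- A gate on the logical qubits at level `l`, as an operator on the physical qubits (level `0`).
The codes `Q_2, …, Q_L` are used on `k_1` copies of their qubits, labelled by `j_1 ∈ [k_1]`, and
`Q_1` encodes one block of `n_1` physical qubits for each `(i_2, …, i_L)`. -/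
def lift : {L : ℕ} → (C : Fin L → BasedCode) → (l : ℕ) → Op (Qubit C l) → Op (Qubit C 0)
  | 0, _, _ => fun U => U
  | _ + 1, _, 0 => fun U => U
  | _ + 1, C, l + 1 => fun U =>
    onCols (R := Qubit (fun i => C i.succ) 0) (C 0).basis.logical
      (onRows (R := Fin (C 0).k) (lift (fun i => C i.succ) l) U)

/-- Stabilizer generators of the concatenated code `Q_L ∘ ⋯ ∘ Q_1`: the stabilizers of `Q_1` on
each of its blocks, and the stabilizer generators of `Q_L ∘ ⋯ ∘ Q_2` on each of its `k_1` copies,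
with logical operators of `Q_1` substituted. -/
def stabGens : {L : ℕ} → (C : Fin L → BasedCode) → Set (Op (Qubit C 0))
  | 0, _ => ∅
  | _ + 1, C =>
    {M | ∃ r : Qubit (fun i => C i.succ) 0, ∃ g ∈ (C 0).code.ops, M = atCol r g} ∪
    {M | ∃ j : Fin (C 0).k, ∃ g ∈ stabGens (fun i => C i.succ),
      M = onCols (R := Qubit (fun i => C i.succ) 0) (C 0).basis.logical (atRow j g)}

/-- The code space of the concatenated code. -/
def codeSpace {L : ℕ} (C : Fin L → BasedCode) : Submodule ℂ (State (Qubit C 0)) :=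
  fixedSpace (stabGens C)

/-- The gate `U` on the logical qubits at level `l` equals (is implemented by) the gate `V` on the
logical qubits at level `m`: they agree on the code space up to a global phase. -/
def GateEq {L : ℕ} (C : Fin L → BasedCode) {l m : ℕ} (U : Op (Qubit C l)) (V : Op (Qubit C m)) :
    Prop :=
  EqOn (codeSpace C) (lift C l U) (lift C m V)

/-- The gate `U` on the logical qubits at level `l` is transversal at level `m`: it is a tensor
product of single-qubit gates on the logical qubits at level `m`. -/
def IsTransversalAt {L : ℕ} (C : Fin L → BasedCode) {l : ℕ} (U : Op (Qubit C l)) (m : ℕ) : Prop :=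
  ∃ G : Qubit C m → Matrix.unitaryGroup (Fin 2) ℂ,
    GateEq C U (tensor fun i => (G i : Matrix (Fin 2) (Fin 2) ℂ))

end QCode

end

open scoped Matrix

namespace QCode

/-! ### Operators vanishing on a fixed space -/

/-! Fix a set `D` of single-qubit gates such that every code in the chain implements each tensor
product of logical gates from `D` by a tensor product of physical gates from `D`, up to phase on its
code space. This property survives concatenation: a logical tensor product can be pushed down one
level at a time, and whatever pattern of factors one code produces is admissible input for the next
(`exists_gateEq_tensor`). Compatibility gives the property for `D = {H}` and for `D = {S, S⁻¹}`; for
the latter it matters that every sign pattern is allowed.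

The difficulty is that gates agree only on code spaces, while gates at an intermediate level are
physical operators obtained by substituting logical Paulis. An identity on an outer code space must
therefore be transported through an inner encoding. This is done algebraically: an operator vanishes
on the common fixed space of `T` only if it is a sum of terms `A * (g - 1)` with `g ∈ T`
(`mem_span_of_vanish_fixedSpace`), and a multiplicative linear map sends such a sum to an operator
killing every vector fixed by the images of `T` (`map_mulVec_eq_of_eqOn`). The encodings are
multiplicative because the operators `|x⟩⟨y|` form a system of matrix units (`logical_mul`,
`onBlocks_mul`).

The induction on the number of codes peels off the innermost code: `gateEq_succ_succ` uses the outer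
codes on their `k_1` independent copies, and `gateEq_one_zero` uses the innermost code on its
blocks. -/

lemma EqOn.refl {ι : Type} [Fintype ι] [DecidableEq ι] (W : Submodule ℂ (State ι)) (U : Op ι) :
    EqOn W U U :=
  ⟨1, by simp, fun ψ _ => by simp⟩

lemma EqOn.trans {ι : Type} [Fintype ι] [DecidableEq ι] {W : Submodule ℂ (State ι)}
    {U V T : Op ι} (h₁ : EqOn W U V) (h₂ : EqOn W V T) : EqOn W U T := by
  obtain ⟨c, hc, h⟩ := h₁
  obtain ⟨d, hd, h'⟩ := h₂
  exact ⟨c * d, by simp [hc, hd], fun ψ hψ => by rw [h ψ hψ, h' ψ hψ, smul_smul]⟩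

/-- An operator that vanishes on the fixed space of `T` lies in the left ideal generated by the
operators `g - 1` with `g ∈ T`. -/
lemma mem_span_of_vanish_fixedSpace {ι : Type} [Fintype ι] [DecidableEq ι] (T : Set (Op ι))
    (M : Op ι) (hM : ∀ ψ ∈ fixedSpace T, M *ᵥ ψ = 0) :
    M ∈ Ideal.span (Set.image (fun g => g - 1) T) := by
  classical
  set I := Ideal.span (Set.image (fun g : Op ι => g - 1) T)
  let row : Op ι → (ι → Fin 2) → Module.Dual ℂ (State ι) := fun N i =>
    (LinearMap.proj i) ∘ₗ Matrix.mulVecLin N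
  -- The span of all rows of the operators `g - 1`. Its common kernel is the fixed space, so by
  -- finite-dimensional duality every functional vanishing there, in particular every row of `M`,
  -- lies in `W`.
  let W : Subspace ℂ (Module.Dual ℂ (State ι)) :=
    Submodule.span ℂ {φ | ∃ g ∈ T, ∃ i, φ = row (g - 1) i}
  have hrow : ∀ i, row M i ∈ W := by
    intro i
    rw [← Subspace.dualCoannihilator_dualAnnihilator_eq (W := W), Submodule.mem_dualAnnihilator]
    intro ψ hψ
    rw [Submodule.mem_dualCoannihilator] at hψ
    have : ψ ∈ fixedSpace T := by
      intro g hg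
      rw [← sub_eq_zero]
      ext j
      have := hψ (row (g - 1) j) (Submodule.subset_span ⟨g, hg, j, rfl⟩)
      simpa [row, Matrix.sub_mulVec] using this
    simp [row, hM ψ this]
  -- Left multiplication by a matrix unit moves a row of `g - 1` to any position, so a matrix with a
  -- single nonzero row taken from `W` is in the ideal; `M` is the sum of such matrices.
  have key : ∀ φ ∈ W, ∀ i : ι → Fin 2,
      Matrix.vecMulVec (Pi.single i 1) (fun j => φ (Pi.single j 1)) ∈ I := by
    intro φ hφ
    induction hφ using Submodule.span_induction with
    | mem φ h =>
      obtain ⟨g, hg, i', rfl⟩ := h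
      intro i
      have : Matrix.vecMulVec (Pi.single i 1) (fun j => row (g - 1) i' (Pi.single j 1))
          = Matrix.single i i' 1 * (g - 1) := by
        ext a b
        by_cases h : i = a
        · subst h; simp [Matrix.vecMulVec_apply, row, Matrix.one_apply, Pi.single_apply]
        · simp [Matrix.vecMulVec_apply, Ne.symm h]
      rw [this]
      exact I.mul_mem_left _ (Ideal.subset_span ⟨g, hg, rfl⟩)
    | zero =>
      intro i
      convert I.zero_mem
      ext a b
      simp [Matrix.vecMulVec_apply]
    | add x y _ _ hx hy =>
      intro i
      convert I.add_mem (hx i) (hy i)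
      ext a b
      simp [Matrix.vecMulVec_apply, mul_add]
    | smul c x _ hx =>
      intro i
      convert I.mul_mem_left (c • (1 : Op ι)) (hx i)
      ext a b
      simp [Matrix.vecMulVec_apply]
      ring
  have hsum : M = ∑ i, Matrix.vecMulVec (Pi.single i 1) (fun j => row M i (Pi.single j 1)) := by
    ext a b
    simp [Matrix.sum_apply, Matrix.vecMulVec_apply, row, Pi.single_apply]
  rw [hsum]
  exact I.sum_mem fun i _ => key _ (hrow i) i

/-- A multiplicative linear map of operators transports equality on a fixed space. -/
lemma map_mulVec_eq_of_eqOn {ι κ : Type} [Fintype ι] [DecidableEq ι] [Fintype κ] [DecidableEq κ]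
    (Ψ : Op ι →ₗ[ℂ] Op κ) (hΨ : ∀ U V, Ψ (U * V) = Ψ U * Ψ V) {T : Set (Op ι)} {U V : Op ι} {c : ℂ}
    (h : ∀ ψ ∈ fixedSpace T, U *ᵥ ψ = c • (V *ᵥ ψ)) {φ : State κ}
    (hφ : ∀ g ∈ T, Ψ g *ᵥ φ = φ) : Ψ U *ᵥ φ = c • (Ψ V *ᵥ φ) := by
  have hI : U - c • V ∈ Ideal.span (Set.image (fun g => g - 1) T) :=
    mem_span_of_vanish_fixedSpace T _ fun ψ hψ => by
      rw [Matrix.sub_mulVec, Matrix.smul_mulVec, h ψ hψ, sub_self]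
  have key : ∀ M ∈ Ideal.span (Set.image (fun g : Op ι => g - 1) T), Ψ M *ᵥ φ = 0 := by
    intro M hM
    rw [Ideal.span] at hM
    -- This induction has the products `A * (g - 1)` as its generators. Expanding `Ψ (A * g - A)`
    -- then avoids `Ψ 1`, which is not assumed to fix `φ`.
    induction hM using Submodule.closure_induction with
    | zero => simp
    | add x y _ _ hx hy => simp [Matrix.add_mulVec, hx, hy]
    | smul_mem A x hx =>
      obtain ⟨g, hg, rfl⟩ := hx
      rw [smul_eq_mul, mul_sub, mul_one, map_sub, hΨ, Matrix.sub_mulVec, ← Matrix.mulVec_mulVec,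
        hφ g hg, sub_self]
  have := key _ hI
  rwa [map_sub, map_smul, Matrix.sub_mulVec, Matrix.smul_mulVec, sub_eq_zero] at this

/-- A system of matrix units defines a multiplicative map. -/
lemma sum_smul_matrixUnits_mul {m S : Type} [Fintype m] [DecidableEq m] [Ring S] [Algebra ℂ S]
    (E : m → m → S) (hE : ∀ a b c d, E a b * E c d = if b = c then E a d else 0)
    (U V : Matrix m m ℂ) :
    ∑ a, ∑ b, (U * V) a b • E a b = (∑ a, ∑ b, U a b • E a b) * ∑ a, ∑ b, V a b • E a b := by
  rw [Finset.sum_mul]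
  refine Finset.sum_congr rfl fun a _ => ?_
  simp only [Matrix.mul_apply, Finset.sum_smul, Finset.sum_mul]
  rw [Finset.sum_comm]
  refine Finset.sum_congr rfl fun b _ => ?_
  simp only [Finset.mul_sum, smul_mul_smul_comm, hE, smul_ite, smul_zero]
  rw [Finset.sum_comm]
  simp

/-! ### Tensor products over blocks of qubits -/

section Blocks

variable {R A I : Type}

/-- The tensor product of operators `M r` on the blocks `e (r, ·)` of qubits. -/
def blockTensor [Fintype R] (e : R × A ≃ I) (M : R → Op A) : Op I :=
  Matrix.of fun x y => ∏ r, M r (fun i => x (e (r, i))) (fun i => y (e (r, i)))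

/-- Configurations of all qubits correspond to families of configurations of the blocks. -/
def blockEquiv (e : R × A ≃ I) : (I → Fin 2) ≃ (R → A → Fin 2) :=
  (e.symm.arrowCongr (Equiv.refl _)).trans (Equiv.curry _ _ _)

variable [Fintype R] [Fintype A]

lemma tensor_eq_blockTensor [Fintype I] (e : R × A ≃ I) (G : I → Matrix (Fin 2) (Fin 2) ℂ) :
    tensor G = blockTensor e fun r => tensor fun i => G (e (r, i)) := by
  ext x y
  simp only [tensor, blockTensor, Matrix.of_apply]
  rw [← Fintype.prod_prod_type' (f := fun r i => G (e (r, i)) (x (e (r, i))) (y (e (r, i))))]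
  exact (Equiv.prod_comp e fun i => G i (x i) (y i)).symm

variable [DecidableEq R]

lemma prod_block_one_apply (e : R × A ≃ I) (s : Finset R) (x y : I → Fin 2) :
    ∏ r ∈ s, (1 : Op A) (fun i => x (e (r, i))) (fun i => y (e (r, i))) =
      if ∀ i, ∀ r ∈ s, x (e (r, i)) = y (e (r, i)) then 1 else 0 := by
  split_ifs with h
  · refine Finset.prod_eq_one fun r hr => ?_
    rw [show (fun i => x (e (r, i))) = fun i => y (e (r, i)) from funext fun i => h i r hr,
      Matrix.one_apply_eq]
  · push Not at h
    obtain ⟨i, r, hr, h⟩ := h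
    exact Finset.prod_eq_zero hr (Matrix.one_apply_ne fun h' => h (congrFun h' i))

/-- The operator `g` on the block `r`, the identity on all other qubits. -/
def atBlock (e : R × A ≃ I) (r : R) : Op A →ₗ[ℂ] Op I where
  toFun g := blockTensor e (Function.update 1 r g)
  map_add' g h := by
    ext x y
    simp only [blockTensor, Matrix.of_apply, Matrix.add_apply,
      ← Finset.mul_prod_erase Finset.univ _ (Finset.mem_univ r), Function.update_self, add_mul]
    congr 2 <;> exact Finset.prod_congr rfl fun s hs => by
      simp [Function.update_of_ne (Finset.ne_of_mem_erase hs)]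
  map_smul' c g := by
    ext x y
    simp only [blockTensor, Matrix.of_apply, Matrix.smul_apply,
      ← Finset.mul_prod_erase Finset.univ _ (Finset.mem_univ r), Function.update_self, smul_eq_mul,
      mul_assoc, RingHom.id_apply]
    congr 2
    exact Finset.prod_congr rfl fun s hs => by
      simp [Function.update_of_ne (Finset.ne_of_mem_erase hs)]

lemma atBlock_def (e : R × A ≃ I) (r : R) (g : Op A) :
    atBlock e r g = blockTensor e (Function.update 1 r g) := rfl

lemma atBlock_apply (e : R × A ≃ I) (r : R) (g : Op A) (x y : I → Fin 2) :
    atBlock e r g x y = if ∀ i r', r' ≠ r → x (e (r', i)) = y (e (r', i)) then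
      g (fun i => x (e (r, i))) (fun i => y (e (r, i))) else 0 := by
  have h : ∏ s ∈ Finset.univ.erase r, (Function.update (1 : R → Op A) r g s)
      (fun i => x (e (s, i))) (fun i => y (e (s, i))) =
      ∏ s ∈ Finset.univ.erase r, (1 : Op A) (fun i => x (e (s, i))) (fun i => y (e (s, i))) :=
    Finset.prod_congr rfl fun s hs => by
      simp [Function.update_of_ne (Finset.ne_of_mem_erase hs)]
  rw [atBlock_def, blockTensor, Matrix.of_apply,
    ← Finset.mul_prod_erase Finset.univ _ (Finset.mem_univ r), h, prod_block_one_apply]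
  simp

/-- Columns and rows become two instances of one block structure: the labelling `e` is the swap for
blocks `(·, r)` and the identity for blocks `(r, ·)`. -/
lemma atCol_eq_atBlock (r : R) (g : Op A) : atCol r g = atBlock (Equiv.prodComm R A) r g := by
  ext x y
  rw [atBlock_apply]
  rfl

lemma atRow_eq_atBlock (r : R) (g : Op A) : atRow r g = atBlock (Equiv.refl (R × A)) r g := by
  ext x y
  rw [atBlock_apply]
  rfl

variable [DecidableEq A] [Fintype I] [DecidableEq I]

/-- Distributivity: a configuration of all qubits is an independent choice of a configuration on
each block. -/
lemma sum_prod_blocks (e : R × A ≃ I) (f : R → (A → Fin 2) → ℂ) :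
    ∑ z : I → Fin 2, ∏ r, f r (fun i => z (e (r, i))) = ∏ r, ∑ w, f r w := by
  rw [Finset.prod_univ_sum, Fintype.piFinset_univ]
  exact Fintype.sum_equiv (blockEquiv e) _ _ fun z => rfl

lemma blockTensor_mul (e : R × A ≃ I) (M N : R → Op A) :
    blockTensor e M * blockTensor e N = blockTensor e fun r => M r * N r := by
  ext x y
  simp only [blockTensor, Matrix.mul_apply, Matrix.of_apply, ← Finset.prod_mul_distrib]
  exact sum_prod_blocks e fun r w =>
    M r (fun i => x (e (r, i))) w * N r w (fun i => y (e (r, i)))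

lemma atBlock_mul (e : R × A ≃ I) (r : R) (g h : Op A) :
    atBlock e r (g * h) = atBlock e r g * atBlock e r h := by
  simp only [atBlock_def, blockTensor_mul]
  congr 1
  ext1 s
  by_cases hs : s = r
  · subst hs; simp
  · simp [hs]

/-- Blockwise equality on code spaces gives equality of tensor products on the common code
space. -/
lemma blockTensor_eqOn (e : R × A ≃ I) {T : Set (Op A)} {U V : R → Op A}
    (h : ∀ r, EqOn (fixedSpace T) (U r) (V r)) {W : Submodule ℂ (State I)}
    (hW : ∀ ψ ∈ W, ∀ r, ∀ g ∈ T, atBlock e r g *ᵥ ψ = ψ) :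
    EqOn W (blockTensor e U) (blockTensor e V) := by
  choose c hc h using h
  refine ⟨∏ r, c r, by simp [norm_prod, hc], fun ψ hψ => ?_⟩
  -- The blocks are exchanged one at a time, with the identity on blocks outside `s`.
  have key : ∀ s : Finset R, blockTensor e (s.piecewise U 1) *ᵥ ψ =
      (∏ r ∈ s, c r) • (blockTensor e (s.piecewise V 1) *ᵥ ψ) := by
    intro s
    induction s using Finset.induction_on with
    | empty => simp
    | insert r s hr ih =>
      have h₁ : ∀ U : R → Op A, blockTensor e ((insert r s).piecewise U 1) =
          blockTensor e (s.piecewise U 1) * atBlock e r (U r) := by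
        intro U
        rw [atBlock_def, blockTensor_mul]
        congr 1
        ext1 t
        by_cases ht : t = r
        · subst ht; simp [hr]
        · by_cases hts : t ∈ s <;> simp [ht, hts]
      have h₂ : ∀ (U : R → Op A) (M : Op A), blockTensor e (s.piecewise U 1) * atBlock e r M =
          atBlock e r M * blockTensor e (s.piecewise U 1) := by
        intro U M
        rw [atBlock_def, blockTensor_mul, blockTensor_mul]
        congr 1
        ext1 t
        by_cases ht : t = r
        · subst ht; simp [hr]
        · simp [ht]
      -- The factor on block `r` acts on `ψ` first, where the stabilizers fix `ψ`. The induction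
      -- hypothesis also concerns `ψ` itself, so `V r` is commuted to the left before it is used,
      -- and back afterwards.
      rw [h₁, h₁ V, ← Matrix.mulVec_mulVec,
        map_mulVec_eq_of_eqOn (atBlock e r) (atBlock_mul e r) (h r) (hW ψ hψ r),
        Matrix.mulVec_smul, Matrix.mulVec_mulVec, h₂, ← Matrix.mulVec_mulVec, ih,
        Matrix.mulVec_smul, Matrix.mulVec_mulVec, ← h₂, smul_smul, Finset.prod_insert hr]
  simpa using key Finset.univ

end Blocks

section OnBlocks

variable {R A B I J : Type} [Fintype R] [Fintype A]
  [Fintype I] [DecidableEq I]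

/-- For a linear map `Φ` of operators, the map `⨂ r, Φ`, applied to the blocks of qubits. -/
def onBlocks (e : R × A ≃ I) (f : R × B ≃ J) (Φ : Op A → Op B) : Op I →ₗ[ℂ] Op J where
  toFun U := ∑ a, ∑ b, U a b • blockTensor f fun r =>
    Φ (Matrix.single (blockEquiv e a r) (blockEquiv e b r) 1)
  map_add' U V := by simp [add_smul, Finset.sum_add_distrib]
  map_smul' c U := by simp [Finset.smul_sum, smul_smul]

lemma onBlocks_def (e : R × A ≃ I) (f : R × B ≃ J) (Φ : Op A → Op B) (U : Op I) :
    onBlocks e f Φ U = ∑ a, ∑ b, U a b • blockTensor f fun r =>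
      Φ (Matrix.single (blockEquiv e a r) (blockEquiv e b r) 1) := rfl

variable [DecidableEq R] [DecidableEq A]

lemma onCols_eq_onBlocks (Φ : Op A → Op B) (U : Op (A × R)) :
    onCols Φ U = onBlocks (Equiv.prodComm R A) (Equiv.prodComm R B) Φ U := by
  ext x y
  simp only [onBlocks_def, Matrix.sum_apply, Matrix.smul_apply, smul_eq_mul]
  rfl

lemma onRows_eq_onBlocks (Φ : Op A → Op B) (U : Op (R × A)) :
    onRows Φ U = onBlocks (Equiv.refl (R × A)) (Equiv.refl (R × B)) Φ U := by
  ext x y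
  simp only [onBlocks_def, Matrix.sum_apply, Matrix.smul_apply, smul_eq_mul]
  rfl

/-- Multilinearity: expand each `Φ (M r)` over matrix units and distribute the product over the
blocks. -/
lemma onBlocks_blockTensor (e : R × A ≃ I) (f : R × B ≃ J) (Φ : Op A →ₗ[ℂ] Op B)
    (M : R → Op A) : onBlocks e f Φ (blockTensor e M) = blockTensor f fun r => Φ (M r) := by
  ext x y
  have hΦ : ∀ N : Op A, Φ N = ∑ a, ∑ b, N a b • Φ (Matrix.single a b 1) := by
    intro N
    conv_lhs => rw [Matrix.matrix_eq_sum_single N]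
    simp only [map_sum, ← map_smul, Matrix.smul_single, smul_eq_mul, mul_one]
  rw [onBlocks_def]
  simp only [blockTensor, Matrix.sum_apply, Matrix.smul_apply, Matrix.of_apply, smul_eq_mul,
    ← Finset.prod_mul_distrib]
  simp_rw [fun r => hΦ (M r), Matrix.sum_apply, Matrix.smul_apply, smul_eq_mul,
    ← sum_prod_blocks e fun r a => ∑ b, M r a b * Φ (Matrix.single a b 1)
      (fun i => x (f (r, i))) (fun i => y (f (r, i)))]
  refine Finset.sum_congr rfl fun a _ => ?_
  exact sum_prod_blocks e fun r b => M r (fun i => a (e (r, i))) b *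
    Φ (Matrix.single (fun i => a (e (r, i))) b 1) (fun i => x (f (r, i))) (fun i => y (f (r, i)))

variable [Fintype B] [DecidableEq B] [Fintype J] [DecidableEq J]

/-- The images of matrix units again multiply like matrix units: if the inner indices differ, they
differ on some block, and the factor of that block vanishes. -/
lemma onBlocks_mul (e : R × A ≃ I) (f : R × B ≃ J) (Φ : Op A →ₗ[ℂ] Op B)
    (hΦ : ∀ U V, Φ (U * V) = Φ U * Φ V) (U V : Op I) :
    onBlocks e f Φ (U * V) = onBlocks e f Φ U * onBlocks e f Φ V := by
  have hb : ∀ a b c d : I → Fin 2,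
      (blockTensor f fun r => Φ (Matrix.single (blockEquiv e a r) (blockEquiv e b r) 1)) *
      (blockTensor f fun r => Φ (Matrix.single (blockEquiv e c r) (blockEquiv e d r) 1)) =
      if b = c then
        blockTensor f fun r => Φ (Matrix.single (blockEquiv e a r) (blockEquiv e d r) 1)
      else 0 := by
    intro a b c d
    rw [blockTensor_mul]
    simp_rw [← hΦ]
    split_ifs with h
    · subst h; simp
    · have : ∃ r, blockEquiv e b r ≠ blockEquiv e c r := by
        by_contra! h'
        exact h ((blockEquiv e).injective (funext h'))
      obtain ⟨r, hr⟩ := this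
      ext x y
      refine Finset.prod_eq_zero (Finset.mem_univ r) ?_
      beta_reduce
      rw [Matrix.single_mul_single_of_ne (h := hr), map_zero, Matrix.zero_apply]
  exact sum_smul_matrixUnits_mul _ hb U V

end OnBlocks

/-! ### Logical gates -/

namespace SymplecticBasis

variable {n k : ℕ} {Q : StabilizerCode n k}

lemma Z_mul_Z (B : SymplecticBasis Q) (j j' : Fin k) :
    (B.Z j : Op (Fin n)) * B.Z j' = B.Z j' * B.Z j :=
  congrArg Subtype.val (B.Z_Z j j')

lemma Z_mul_self (B : SymplecticBasis Q) (j : Fin k) :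
    (B.Z j : Op (Fin n)) * B.Z j = 1 :=
  congrArg Subtype.val (B.Z_sq j)

lemma Z_mul_X_pow (B : SymplecticBasis Q) (j j' : Fin k) (x : Fin 2) :
    (B.Z j : Op (Fin n)) * (B.X j' : Op (Fin n)) ^ (x : ℕ) =
      (if j' = j then (-1 : ℂ) ^ (x : ℕ) else 1) •
        ((B.X j' : Op (Fin n)) ^ (x : ℕ) * B.Z j) := by
  have h : (B.Z j : Op (Fin n)) * B.X j' =
      (if j' = j then (-1 : ℂ) else 1) • ((B.X j' : Op (Fin n)) * B.Z j) := by
    split_ifs with h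
    · subst h
      rw [B.anticomm, neg_one_smul, neg_neg]
    · rw [one_smul]
      exact (congrArg Subtype.val (B.X_Z j' j h)).symm
  fin_cases x
  · simp
  · simpa using h

lemma Z_mul_prod_X_pow (B : SymplecticBasis Q) (j : Fin k) (x : Fin k → Fin 2)
    (l : List (Fin k)) :
    (B.Z j : Op (Fin n)) * (l.map fun i => (B.X i : Op (Fin n)) ^ (x i : ℕ)).prod =
      (l.map fun i => if i = j then (-1 : ℂ) ^ (x i : ℕ) else 1).prod •
        ((l.map fun i => (B.X i : Op (Fin n)) ^ (x i : ℕ)).prod * B.Z j) := by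
  induction l with
  | nil => simp
  | cons i l ih =>
    simp only [List.map_cons, List.prod_cons]
    rw [← mul_assoc, Z_mul_X_pow, smul_mul_assoc, mul_assoc, ih, mul_smul_comm, smul_smul,
      mul_assoc]

/-- Only the factor `X j` anticommutes with `Z j`. Hence `xPow x` maps the `+1` eigenspace of `Z j`
to its `(-1) ^ x j` eigenspace. -/
lemma Z_mul_xPow (B : SymplecticBasis Q) (j : Fin k) (x : Fin k → Fin 2) :
    (B.Z j : Op (Fin n)) * B.xPow x = (-1 : ℂ) ^ (x j : ℕ) • (B.xPow x * B.Z j) := by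
  have h := B.Z_mul_prod_X_pow j x (List.finRange k)
  rw [← List.ofFn_eq_map, ← List.ofFn_eq_map, List.prod_ofFn,
    Finset.prod_ite_eq' Finset.univ j, if_pos (Finset.mem_univ j)] at h
  exact h

lemma xPow_conjTranspose_mul_self (B : SymplecticBasis Q) (x : Fin k → Fin 2) :
    (B.xPow x)ᴴ * B.xPow x = 1 := by
  have h : B.xPow x ∈ Matrix.unitaryGroup (Fin n → Fin 2) ℂ := by
    refine list_prod_mem fun M hM => ?_
    obtain ⟨j, rfl⟩ := (List.mem_ofFn' _ _).1 hM
    exact pow_mem (B.X j).2 _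
  exact (Matrix.mem_unitaryGroup_iff').1 h

lemma Z_mul_zeroProj (B : SymplecticBasis Q) (j : Fin k) :
    (B.Z j : Op (Fin n)) * B.zeroProj = B.zeroProj := by
  have key : ∀ l : List (Fin k), j ∈ l → (B.Z j : Op (Fin n)) *
      (l.map fun i => (2 : ℂ)⁻¹ • (1 + (B.Z i : Op (Fin n)))).prod =
      (l.map fun i => (2 : ℂ)⁻¹ • (1 + (B.Z i : Op (Fin n)))).prod := by
    intro l hl
    induction l with
    | nil => simp at hl
    | cons i l ih =>
      simp only [List.map_cons, List.prod_cons, ← mul_assoc]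
      rcases List.mem_cons.1 hl with rfl | hl
      · congr 1
        rw [mul_smul_comm, mul_add, mul_one, Z_mul_self, add_comm]
      · rw [mul_smul_comm, mul_add, mul_one, Z_mul_Z, ← one_add_mul, ← smul_mul_assoc, mul_assoc,
          ih hl]
  have h := key (List.finRange k) (List.mem_finRange j)
  rw [← List.ofFn_eq_map] at h
  exact h

lemma mul_zeroProj (B : SymplecticBasis Q) (M : Op (Fin n))
    (hM : ∀ j, M * (B.Z j : Op (Fin n)) = M) : M * B.zeroProj = M := by
  have key : ∀ l : List (Fin k),
      M * (l.map fun i => (2 : ℂ)⁻¹ • (1 + (B.Z i : Op (Fin n)))).prod = M := by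
    intro l
    induction l with
    | nil => simp
    | cons i l ih =>
      simp only [List.map_cons, List.prod_cons, ← mul_assoc]
      rw [mul_smul_comm, mul_add, hM, mul_one, ← two_smul ℂ M, smul_smul,
        inv_mul_cancel₀ two_ne_zero, one_smul, ih]
  have h := key (List.finRange k)
  rw [← List.ofFn_eq_map] at h
  exact h

lemma zeroProj_mul_Z (B : SymplecticBasis Q) (j : Fin k) :
    B.zeroProj * (B.Z j : Op (Fin n)) = B.zeroProj := by
  have h : Commute (B.Z j : Op (Fin n)) B.zeroProj := by
    refine Commute.list_prod_right _ _ fun M hM => ?_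
    obtain ⟨i, rfl⟩ := (List.mem_ofFn' _ _).1 hM
    exact ((Commute.one_right _).add_right (B.Z_mul_Z j i)).smul_right _
  rw [← h.eq, Z_mul_zeroProj]

lemma zeroProj_mul_self (B : SymplecticBasis Q) : B.zeroProj * B.zeroProj = B.zeroProj :=
  B.mul_zeroProj _ B.zeroProj_mul_Z

lemma Z_conjTranspose (B : SymplecticBasis Q) (j : Fin k) :
    (B.Z j : Op (Fin n))ᴴ = B.Z j := by
  have h : star (B.Z j : Op (Fin n)) * B.Z j = 1 := Unitary.coe_star_mul_self (B.Z j)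
  have h' := congrArg (· * (B.Z j : Op (Fin n))) h
  simpa [mul_assoc, Z_mul_self, Matrix.star_eq_conjTranspose] using h'

/-- The logical basis states are orthonormal. -/
lemma zeroProj_xPow_xPow_zeroProj (B : SymplecticBasis Q) (x y : Fin k → Fin 2) :
    B.zeroProj * (B.xPow x)ᴴ * (B.xPow y * B.zeroProj) = if x = y then B.zeroProj else 0 := by
  split_ifs with h
  · subst h
    rw [mul_assoc, ← mul_assoc (B.xPow x)ᴴ, xPow_conjTranspose_mul_self, one_mul,
      zeroProj_mul_self]
  · obtain ⟨j, hj⟩ := Function.ne_iff.1 h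
    have hZ (z : Fin k → Fin 2) :
        (B.Z j : Op (Fin n)) * (B.xPow z * B.zeroProj) =
          (-1 : ℂ) ^ (z j : ℕ) • (B.xPow z * B.zeroProj) := by
      rw [← mul_assoc, Z_mul_xPow, smul_mul_assoc, mul_assoc, Z_mul_zeroProj]
    have hZ' (z : Fin k → Fin 2) :
        B.zeroProj * (B.xPow z)ᴴ * (B.Z j : Op (Fin n)) =
          (-1 : ℂ) ^ (z j : ℕ) • (B.zeroProj * (B.xPow z)ᴴ) := by
      have h1 := congrArg Matrix.conjTranspose (B.Z_mul_xPow j z)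
      simp only [Matrix.conjTranspose_mul, Matrix.conjTranspose_smul, Z_conjTranspose, star_pow,
        star_neg, star_one] at h1
      rw [mul_assoc, h1, mul_smul_comm, ← mul_assoc, zeroProj_mul_Z]
    -- Insert `Z j` in the middle and let it act to either side: the eigenvalues `(-1) ^ x j` and
    -- `(-1) ^ y j` differ, so the product is zero.
    have h1 := (mul_assoc (B.zeroProj * (B.xPow x)ᴴ) (B.Z j : Op (Fin n)) (B.xPow y * B.zeroProj))
    rw [hZ, hZ', smul_mul_assoc, mul_smul_comm] at h1
    have hne : (-1 : ℂ) ^ (x j : ℕ) - (-1 : ℂ) ^ (y j : ℕ) ≠ 0 := by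
      generalize x j = s at hj ⊢
      generalize y j = t at hj ⊢
      fin_cases s <;> fin_cases t <;> simp at hj ⊢ <;> norm_num
    rw [← sub_eq_zero, ← sub_smul] at h1
    exact (smul_eq_zero.1 h1).resolve_left hne

/-- `logical` as a linear map. -/
noncomputable def logicalLin (B : SymplecticBasis Q) : Op (Fin k) →ₗ[ℂ] Op (Fin n) where
  toFun := B.logical
  map_add' U V := by simp [logical, add_smul, Finset.sum_add_distrib]
  map_smul' c U := by simp [logical, Finset.smul_sum, smul_smul]

/-- The matrix-unit relations use only the relations among the logical Paulis, so they hold on the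
whole physical space and not merely on the code space. -/
lemma logical_mul (B : SymplecticBasis Q) (U V : Op (Fin k)) :
    B.logical (U * V) = B.logical U * B.logical V := by
  have hb : ∀ a b c d : Fin k → Fin 2,
      B.xPow a * B.zeroProj * (B.xPow b)ᴴ * (B.xPow c * B.zeroProj * (B.xPow d)ᴴ) =
        if b = c then B.xPow a * B.zeroProj * (B.xPow d)ᴴ else 0 := by
    intro a b c d
    rw [show B.xPow a * B.zeroProj * (B.xPow b)ᴴ * (B.xPow c * B.zeroProj * (B.xPow d)ᴴ) =
      B.xPow a * (B.zeroProj * (B.xPow b)ᴴ * (B.xPow c * B.zeroProj)) * (B.xPow d)ᴴ by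
        simp only [mul_assoc], zeroProj_xPow_xPow_zeroProj]
    split_ifs <;> simp
  exact sum_smul_matrixUnits_mul _ hb U V

end SymplecticBasis

/-! ### Concatenated codes -/

lemma lift_zero {L : ℕ} (C : Fin L → BasedCode) (U : Op (Qubit C 0)) : lift C 0 U = U := by
  cases L <;> rfl

/-- The recursion step of `lift`, in terms of linear maps. -/
noncomputable def liftStep {L : ℕ} (C : Fin (L + 1) → BasedCode) (l : ℕ) :
    Op (Fin (C 0).k × Qubit (fun i => C i.succ) l) →ₗ[ℂ]
      Op (Fin (C 0).n × Qubit (fun i => C i.succ) 0) :=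
  onBlocks (Equiv.prodComm (Qubit (fun i => C i.succ) 0) (Fin (C 0).k))
      (Equiv.prodComm (Qubit (fun i => C i.succ) 0) (Fin (C 0).n)) (C 0).basis.logical ∘ₗ
    onBlocks (Equiv.refl (Fin (C 0).k × Qubit (fun i => C i.succ) l))
      (Equiv.refl (Fin (C 0).k × Qubit (fun i => C i.succ) 0)) (lift (fun i => C i.succ) l)

lemma lift_succ {L : ℕ} (C : Fin (L + 1) → BasedCode) (l : ℕ)
    (U : Op (Fin (C 0).k × Qubit (fun i => C i.succ) l)) :
    lift C (l + 1) U = liftStep C l U :=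
  (onCols_eq_onBlocks _ _).trans (congrArg _ (onRows_eq_onBlocks _ _))

lemma lift_add {L : ℕ} (C : Fin L → BasedCode) (l : ℕ) (U V : Op (Qubit C l)) :
    lift C l (U + V) = lift C l U + lift C l V := by
  cases L with
  | zero => rfl
  | succ L =>
    cases l with
    | zero => rfl
    | succ l =>
      exact (lift_succ C l _).trans (((liftStep C l).map_add U V).trans
        (congrArg₂ (· + ·) (lift_succ C l U).symm (lift_succ C l V).symm))

lemma lift_smul {L : ℕ} (C : Fin L → BasedCode) (l : ℕ) (c : ℂ) (U : Op (Qubit C l)) :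
    lift C l (c • U) = c • lift C l U := by
  cases L with
  | zero => rfl
  | succ L =>
    cases l with
    | zero => rfl
    | succ l =>
      exact (lift_succ C l _).trans (((liftStep C l).map_smul c U).trans
        (congrArg (c • ·) (lift_succ C l U).symm))

/-- `lift` as a linear map. -/
noncomputable def liftLin {L : ℕ} (C : Fin L → BasedCode) (l : ℕ) :
    Op (Qubit C l) →ₗ[ℂ] Op (Qubit C 0) where
  toFun := lift C l
  map_add' := lift_add C l
  map_smul' := lift_smul C l

lemma lift_succ_tensor {L : ℕ} (C : Fin (L + 1) → BasedCode) (l : ℕ)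
    (F : Fin (C 0).k × Qubit (fun i => C i.succ) l → Matrix (Fin 2) (Fin 2) ℂ) :
    lift C (l + 1) (tensor (ι := Qubit C (l + 1)) F) =
      onBlocks (Equiv.prodComm (Qubit (fun i => C i.succ) 0) (Fin (C 0).k))
        (Equiv.prodComm (Qubit (fun i => C i.succ) 0) (Fin (C 0).n)) (C 0).basis.logicalLin
        (blockTensor (Equiv.refl _) fun j =>
          lift (fun i => C i.succ) l (tensor fun q => F (j, q))) := by
  have h := onBlocks_blockTensor (Equiv.refl (Fin (C 0).k × Qubit (fun i => C i.succ) l))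
    (Equiv.refl (Fin (C 0).k × Qubit (fun i => C i.succ) 0)) (liftLin (fun i => C i.succ) l)
    (fun j => tensor fun q => F (j, q))
  have h' := tensor_eq_blockTensor (Equiv.refl (Fin (C 0).k × Qubit (fun i => C i.succ) l)) F
  refine (lift_succ C l (tensor F)).trans ?_
  rw [liftStep, LinearMap.comp_apply, h']
  exact congrArg (onBlocks _ _ _) h

lemma mem_codeSpace_atCol {L : ℕ} (C : Fin (L + 1) → BasedCode) {ψ : State (Qubit C 0)}
    (hψ : ψ ∈ codeSpace C) (r : Qubit (fun i => C i.succ) 0) {g : Op (Fin (C 0).n)}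
    (hg : g ∈ (C 0).code.ops) :
    atBlock (Equiv.prodComm (Qubit (fun i => C i.succ) 0) (Fin (C 0).n)) r g *ᵥ ψ = ψ := by
  rw [← atCol_eq_atBlock]
  exact hψ _ (Or.inl ⟨r, g, hg, rfl⟩)

/-- This supplies the invariance needed to transport identities of the outer codes through the
innermost encoding. -/
lemma mem_codeSpace_atRow {L : ℕ} (C : Fin (L + 1) → BasedCode) {ψ : State (Qubit C 0)}
    (hψ : ψ ∈ codeSpace C) (j : Fin (C 0).k) {g : Op (Qubit (fun i => C i.succ) 0)}
    (hg : g ∈ stabGens (fun i => C i.succ)) :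
    onBlocks (Equiv.prodComm (Qubit (fun i => C i.succ) 0) (Fin (C 0).k))
      (Equiv.prodComm (Qubit (fun i => C i.succ) 0) (Fin (C 0).n)) (C 0).basis.logicalLin
      (atBlock (Equiv.refl _) j g) *ᵥ ψ = ψ := by
  rw [← atRow_eq_atBlock]
  have h := onCols_eq_onBlocks (R := Qubit (fun i => C i.succ) 0) (C 0).basis.logical
    (atRow j g)
  exact (congrArg (· *ᵥ ψ) h.symm).trans (hψ _ (Or.inr ⟨j, g, hg, rfl⟩))

/-- If the outer codes turn each of the gates `F (j, ·)` into `G (j, ·)`, then so does the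
concatenated code with all these gates together. -/
lemma gateEq_succ_succ {L : ℕ} (C : Fin (L + 1) → BasedCode) {l m : ℕ}
    (F : Fin (C 0).k × Qubit (fun i => C i.succ) l → Matrix (Fin 2) (Fin 2) ℂ)
    (G : Fin (C 0).k × Qubit (fun i => C i.succ) m → Matrix (Fin 2) (Fin 2) ℂ)
    (h : ∀ j, GateEq (fun i => C i.succ) (tensor fun q => F (j, q)) (tensor fun q => G (j, q))) :
    GateEq C (tensor (ι := Qubit C (l + 1)) F) (tensor (ι := Qubit C (m + 1)) G) := by
  -- The fixed space of `T` is the code space of the `k_1` independent copies of the outer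
  -- concatenated code, before encoding by the innermost code.
  let T : Set (Op (Fin (C 0).k × Qubit (fun i => C i.succ) 0)) :=
    {M | ∃ j, ∃ g ∈ stabGens (fun i => C i.succ), M = atBlock (Equiv.refl _) j g}
  obtain ⟨c, hc, hT⟩ := blockTensor_eqOn (Equiv.refl (Fin (C 0).k × Qubit (fun i => C i.succ) 0))
    h (W := fixedSpace T) fun ψ hψ j g hg => hψ _ ⟨j, g, hg, rfl⟩
  refine ⟨c, hc, fun ψ hψ => ?_⟩
  rw [lift_succ_tensor, lift_succ_tensor]
  refine map_mulVec_eq_of_eqOn _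
    (onBlocks_mul _ _ (C 0).basis.logicalLin (C 0).basis.logical_mul) hT ?_
  rintro _ ⟨j, g, hg, rfl⟩
  exact mem_codeSpace_atRow C hψ j hg

/-- If the innermost code turns each of the gates `F (·, r)` into `G (·, r)`, then so does the
concatenated code with all these gates together. -/
lemma gateEq_one_zero {L : ℕ} (C : Fin (L + 1) → BasedCode)
    (F : Fin (C 0).k × Qubit (fun i => C i.succ) 0 → Matrix (Fin 2) (Fin 2) ℂ)
    (G : Fin (C 0).n × Qubit (fun i => C i.succ) 0 → Matrix (Fin 2) (Fin 2) ℂ)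
    (h : ∀ r, EqOn (C 0).code.codeSpace ((C 0).basis.logical (tensor fun j => F (j, r)))
      (tensor fun i => G (i, r))) :
    GateEq C (tensor (ι := Qubit C 1) F) (tensor (ι := Qubit C 0) G) := by
  have hF : lift C 1 (tensor (ι := Qubit C 1) F) =
      blockTensor (Equiv.prodComm (Qubit (fun i => C i.succ) 0) (Fin (C 0).n)) fun r =>
        (C 0).basis.logical (tensor fun j => F (j, r)) := by
    rw [lift_succ_tensor]
    simp only [lift_zero]
    have h' := tensor_eq_blockTensor (Equiv.refl (Fin (C 0).k × Qubit (fun i => C i.succ) 0)) F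
    -- The same tensor product is regrouped, from the copies `j` of the outer codes to the blocks
    -- `r` of the innermost code.
    refine (congrArg _ (h'.symm.trans (tensor_eq_blockTensor
      (Equiv.prodComm (Qubit (fun i => C i.succ) 0) (Fin (C 0).k)) F))).trans ?_
    exact onBlocks_blockTensor _ _ (C 0).basis.logicalLin _
  have hG : lift C 0 (tensor (ι := Qubit C 0) G) =
      blockTensor (Equiv.prodComm (Qubit (fun i => C i.succ) 0) (Fin (C 0).n)) fun r =>
        tensor fun i => G (i, r) :=
    tensor_eq_blockTensor (Equiv.prodComm (Qubit (fun i => C i.succ) 0) (Fin (C 0).n)) G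
  rw [GateEq, hF, hG]
  exact blockTensor_eqOn _ h fun ψ hψ r g hg => mem_codeSpace_atCol C hψ r hg

/-- If every code of the concatenation turns transversal gates with factors in `D` into transversal
gates with factors in `D`, then so does the concatenated code, at every level. -/
theorem exists_gateEq_tensor (D : Set (Matrix (Fin 2) (Fin 2) ℂ)) {L : ℕ}
    (C : Fin L → BasedCode)
    (hD : ∀ l, ∀ F : Fin (C l).k → D, ∃ G : Fin (C l).n → D, EqOn (C l).code.codeSpace
      ((C l).basis.logical (tensor fun j => (F j : Matrix (Fin 2) (Fin 2) ℂ)))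
      (tensor fun i => (G i : Matrix (Fin 2) (Fin 2) ℂ)))
    (F : Qubit C L → D) {m : ℕ} (hm : m ≤ L) :
    ∃ G : Qubit C m → D, GateEq C (tensor fun q => (F q : Matrix (Fin 2) (Fin 2) ℂ))
      (tensor fun q => (G q : Matrix (Fin 2) (Fin 2) ℂ)) := by
  induction L generalizing m with
  | zero =>
    obtain rfl : m = 0 := by omega
    exact ⟨F, EqOn.refl _ _⟩
  | succ L ih =>
    -- Levels from `1` on are reached by the outer codes alone, separately for each copy `j`. Level
    -- `0` needs one further use of the innermost code, starting from level `1`.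
    have step : ∀ m ≤ L, ∃ G : Qubit C (m + 1) → D,
        GateEq C (tensor fun q => (F q : Matrix (Fin 2) (Fin 2) ℂ))
          (tensor fun q => (G q : Matrix (Fin 2) (Fin 2) ℂ)) := by
      intro m hm
      choose G hG using fun j : Fin (C 0).k =>
        ih (fun i => C i.succ) (fun l => hD l.succ) (fun q => F (j, q)) hm
      exact ⟨fun q => G q.1 q.2, gateEq_succ_succ C (fun q => (F q : Matrix (Fin 2) (Fin 2) ℂ))
        (fun q => (G q.1 q.2 : Matrix (Fin 2) (Fin 2) ℂ)) hG⟩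
    cases m with
    | succ m => exact step m (by omega)
    | zero =>
      obtain ⟨E, hE⟩ := step 0 (Nat.zero_le _)
      choose G hG using fun r : Qubit (fun i => C i.succ) 0 => hD 0 fun j => E (j, r)
      exact ⟨fun q => G q.2 q.1, hE.trans (gateEq_one_zero C
        (fun q => (E q : Matrix (Fin 2) (Fin 2) ℂ))
        (fun q => (G q.2 q.1 : Matrix (Fin 2) (Fin 2) ℂ)) hG)⟩

/-! ### The gates `H` and `S` -/

lemma hadamard_mem_unitaryGroup : hadamard ∈ Matrix.unitaryGroup (Fin 2) ℂ := by
  have h : ((Real.sqrt 2 : ℝ) : ℂ) * ((Real.sqrt 2 : ℝ) : ℂ) = 2 := by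
    rw [← Complex.ofReal_mul, Real.mul_self_sqrt (by norm_num)]
    norm_num
  have h' : ((Real.sqrt 2 : ℝ) : ℂ)⁻¹ * ((Real.sqrt 2 : ℝ) : ℂ)⁻¹ = 2⁻¹ := by
    rw [← mul_inv, h]
  rw [Matrix.mem_unitaryGroup_iff, Matrix.star_eq_conjTranspose]
  ext i j
  fin_cases i <;> fin_cases j <;>
    simp [hadamard, Matrix.mul_apply, Fin.sum_univ_two, h'] <;> norm_num

lemma phase_mem_unitaryGroup : phase ∈ Matrix.unitaryGroup (Fin 2) ℂ := by
  rw [Matrix.mem_unitaryGroup_iff, Matrix.star_eq_conjTranspose]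
  ext i j
  fin_cases i <;> fin_cases j <;> simp [phase, Matrix.mul_apply, Fin.sum_univ_two]

lemma phase_zpow_mem_unitaryGroup (a : ℤˣ) :
    phase ^ ((a : ℤˣ) : ℤ) ∈ Matrix.unitaryGroup (Fin 2) ℂ := by
  rcases Int.units_eq_one_or a with rfl | rfl
  · simpa using phase_mem_unitaryGroup
  · have h : phase⁻¹ = star phase :=
      Matrix.inv_eq_left_inv (Matrix.mem_unitaryGroup_iff'.1 phase_mem_unitaryGroup)
    simpa [h] using Unitary.star_mem phase_mem_unitaryGroup

end QCode

theorem corollary2 {L : ℕ} (C : Fin L → QCode.BasedCode)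
    (hk : ∀ l, 1 ≤ (C l).k)
    (hcss : ∀ l, (C l).code.IsSelfDualCSS)
    (hcompat : ∀ l, (C l).basis.IsCompatible) :
    ((∀ m ≤ L, QCode.IsTransversalAt C
        (QCode.tensor fun _ : QCode.Qubit C L => QCode.hadamard) m) ∧
      QCode.GateEq C (QCode.tensor fun _ : QCode.Qubit C L => QCode.hadamard)
        (QCode.tensor fun _ : QCode.Qubit C 0 => QCode.hadamard)) ∧
    ∀ a : QCode.Qubit C L → ℤˣ,
      (∀ m ≤ L, QCode.IsTransversalAt C
        (QCode.tensor fun j : QCode.Qubit C L => QCode.phase ^ ((a j : ℤˣ) : ℤ)) m) ∧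
      ∃ b : QCode.Qubit C 0 → ℤˣ,
        QCode.GateEq C (QCode.tensor fun j : QCode.Qubit C L => QCode.phase ^ ((a j : ℤˣ) : ℤ))
          (QCode.tensor fun i : QCode.Qubit C 0 => QCode.phase ^ ((b i : ℤˣ) : ℤ)) := by
  have hH : ∀ m ≤ L, QCode.GateEq C (QCode.tensor fun _ : QCode.Qubit C L => QCode.hadamard)
      (QCode.tensor fun _ : QCode.Qubit C m => QCode.hadamard) := by
    intro m hm
    -- With a singleton `D`, membership forces every factor at level `m` to be `H`.
    obtain ⟨G, hG⟩ := QCode.exists_gateEq_tensor {QCode.hadamard} C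
      (fun l F => ⟨fun _ => ⟨QCode.hadamard, rfl⟩, by
        rw [show (fun j => (F j : Matrix (Fin 2) (Fin 2) ℂ)) = fun _ => QCode.hadamard from
          funext fun j => (F j).2]
        exact (hcompat l).hadamard⟩)
      (fun _ => ⟨QCode.hadamard, rfl⟩) hm
    rwa [show (fun q => (G q : Matrix (Fin 2) (Fin 2) ℂ)) = fun _ => QCode.hadamard from
      funext fun q => (G q).2] at hG
  have hS : ∀ (a : QCode.Qubit C L → ℤˣ), ∀ m ≤ L, ∃ b : QCode.Qubit C m → ℤˣ,
      QCode.GateEq C (QCode.tensor fun j => QCode.phase ^ ((a j : ℤˣ) : ℤ))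
        (QCode.tensor fun i => QCode.phase ^ ((b i : ℤˣ) : ℤ)) := by
    intro a m hm
    -- Here `D = {S, S⁻¹}`; the signs are recovered from membership of the factors in this range.
    obtain ⟨G, hG⟩ := QCode.exists_gateEq_tensor
      (Set.range fun a : ℤˣ => QCode.phase ^ ((a : ℤˣ) : ℤ)) C
      (fun l F => by
        choose a ha using fun j => (F j).2
        obtain ⟨b, hb⟩ := (hcompat l).phase a
        refine ⟨fun i => ⟨_, b i, rfl⟩, ?_⟩
        rwa [← show _ = fun j => (F j : Matrix (Fin 2) (Fin 2) ℂ) from funext ha])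
      (fun q => ⟨_, a q, rfl⟩) hm
    choose b hb using fun q => (G q).2
    exact ⟨b, by rwa [← show _ = fun q => (G q : Matrix (Fin 2) (Fin 2) ℂ) from funext hb] at hG⟩
  refine ⟨⟨fun m hm => ⟨fun _ => ⟨_, QCode.hadamard_mem_unitaryGroup⟩, hH m hm⟩,
    hH 0 (Nat.zero_le L)⟩, fun a => ⟨fun m hm => ?_, hS a 0 (Nat.zero_le L)⟩⟩
  obtain ⟨b, hb⟩ := hS a m hm
  exact ⟨fun i => ⟨_, QCode.phase_zpow_mem_unitaryGroup (b i)⟩, hb⟩
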